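/- Let $\Bbbk$ be a field, $R=\Bbbk[x_1,\dots,x_n]$, let $\mathfrak a_\bullet=\{\mathfrak a_i\}_{i\ge1}$ be a graded family of monomial ideals of $R$ (that is, $\mathfrak a_p\mathfrak a_q\subseteq\mathfrak a_{p+q}$ for all $p,q\ge1$), and let $\mathfrak b\subseteq R$ be a squarefree monomial ideal. Notation. For families of ideals $\mathfrak a_\bullet,\mathfrak c_\bullet$ put $$\widehat\rho(\mathfrak a_\bullet,\mathfrak c_\bullet)=\sup\Big\{\tfrac sr \;\Big|\; s,r\ge1,\ \mathfrak a_{st}\not\subseteq\mathfrak c_{rt}\text{ for all } t\gg0\Big\},$$ and let $\overline{\mathfrak b^\bullet}=\{\overline{\mathfrak b^i}\}_{i\ge1}$ be the family of integral closures of the powers of $\mathfrak b$. For a monomial ideal $I$ let $\mathrm{NP}(I)\subseteq\mathbb R^n_{\ge0}$ be its Newton polyhedron, the convex hull of $\{\mathbf u\in\mathbb Z^n_{\ge0}\mid x^{\mathbf u}\in I\}$, and put $\Delta(\mathfrak a_\bullet)=\overline{\bigcup_{k\ge1}\frac1k\mathrm{NP}(\mathfrak a_k)}$. For a squarefree monomial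 ideal $I$ let $\mathrm{SP}(I)=\bigcap_{\mathfrak p\in\mathrm{Ass}(I)}\mathrm{NP}(\mathfrak p)$ (the intersection being taken inside $\mathbb R^n_{\ge0}$, so that it is $\mathbb R^n_{\ge0}$ if $I=R$), and let $I^\vee=\big\langle\prod_{x_i\in\mathfrak p}x_i \mid \mathfrak p\in\mathrm{Ass}(I)\big\rangle$ be its Alexander dual. Here $\mathrm{Ass}(I)$ is the set of associated primes of $R/I$. The suprema of sets of numbers are taken in $[-\infty,\infty]$, with $\sup\emptyset=-\infty$. Then $$\widehat\rho(\mathfrak a_\bullet,\overline{\mathfrak b^\bullet})=\sup\{\lambda>0 \mid \lambda\cdot\Delta(\mathfrak a_\bullet)\not\subseteq\mathrm{NP}(\mathfrak b)\}.$$ If moreover the set $\{\lambda>0 \mid \lambda\cdot\Delta(\mathfrak a_\bullet)\not\subseteq\mathrm{NP}(\mathfrak b)\}$ is nonempty, then this number also equals $$\frac1{\inf\{\langle\mathbf a,\mathbf b\rangle \mid \mathbf a\in\Delta(\mathfrak a_\bullet),\ \mathbf b\in\mathrm{SP}(\mathfrak b^\vee)\}},$$ where $\frac10=\infty$. -/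

import Mathlib

open scoped ENNReal Pointwise

namespace AsympRes

section IntegralClosure

variable {R : Type*} [CommRing R]

/-- `x` is integral over the ideal `I`: it satisfies an equation
`x ^ m + c₁ x ^ (m - 1) + ⋯ + cₘ = 0` with `m ≥ 1` and `cⱼ ∈ I ^ j`. -/
def IsIntegralOverIdeal (I : Ideal R) (x : R) : Prop :=
  ∃ m : ℕ, 1 ≤ m ∧ ∃ c : ℕ → R, (∀ j ∈ Finset.Icc 1 m, c j ∈ I ^ j) ∧
    x ^ m + ∑ j ∈ Finset.Icc 1 m, c j * x ^ (m - j) = 0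

theorem isIntegralOverIdeal_iff (I : Ideal R) (x : R) :
    IsIntegralOverIdeal I x ↔
      IsIntegral (reesAlgebra I) (Polynomial.monomial 1 x : Polynomial R) := by
  constructor
  · rintro ⟨m, hm, c, hc, h⟩
    let d : ℕ → reesAlgebra I := fun j =>
      if hj : j ∈ Finset.Icc 1 m then
        ⟨Polynomial.monomial j (c j), reesAlgebra.monomial_mem.2 (hc j hj)⟩ else 0
    refine ⟨Polynomial.X ^ m +
      ∑ j ∈ Finset.Icc 1 m, Polynomial.C (d j) * Polynomial.X ^ (m - j), ?_, ?_⟩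
    · refine Polynomial.monic_X_pow_add ?_
      refine (Polynomial.degree_sum_le _ _).trans_lt ?_
      refine (Finset.sup_lt_iff (by exact WithBot.bot_lt_coe m)).2 ?_
      intro j hj
      refine (Polynomial.degree_C_mul_X_pow_le _ _).trans_lt ?_
      rw [Finset.mem_Icc] at hj
      exact_mod_cast (by omega : m - j < m)
    · have key : ∀ j ∈ Finset.Icc 1 m,
          ((d j : Polynomial R)) * (Polynomial.monomial 1 x) ^ (m - j)
            = Polynomial.monomial m (c j * x ^ (m - j)) := by
        intro j hj
        have hj' := Finset.mem_Icc.1 hj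
        have hd : (d j : Polynomial R) = Polynomial.monomial j (c j) := by
          simp only [d, dif_pos hj]
        rw [hd, Polynomial.monomial_pow, Polynomial.monomial_mul_monomial, one_mul,
          Nat.add_sub_cancel' hj'.2]
      rw [Polynomial.eval₂_add, Polynomial.eval₂_X_pow, Polynomial.eval₂_finsetSum]
      have : ∀ j ∈ Finset.Icc 1 m,
          Polynomial.eval₂ (algebraMap (reesAlgebra I) (Polynomial R)) (Polynomial.monomial 1 x)
            (Polynomial.C (d j) * Polynomial.X ^ (m - j))
            = Polynomial.monomial m (c j * x ^ (m - j)) := by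
        intro j hj
        rw [Polynomial.eval₂_mul, Polynomial.eval₂_C, Polynomial.eval₂_X_pow, ← key j hj]
        rfl
      rw [Finset.sum_congr rfl this, Polynomial.monomial_pow, one_mul, ← map_sum, ← map_add, h,
        map_zero]
  · rintro ⟨P, hP, h⟩
    rcases subsingleton_or_nontrivial R with hR | hR
    · exact ⟨1, le_rfl, fun _ => 0, fun _ _ => zero_mem _, Subsingleton.elim _ _⟩
    set m := P.natDegree with hm
    have hcoeff : ∑ i ∈ Finset.range (m + 1),
        (P.coeff i : Polynomial R).coeff (m - i) * x ^ i = 0 := by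
      rw [Polynomial.eval₂_eq_sum_range] at h
      have h2 := congrArg (fun q => Polynomial.coeff q m) h
      simp only [Polynomial.finsetSum_coeff, Polynomial.coeff_zero] at h2
      rw [← h2]
      refine Finset.sum_congr rfl fun i hi => ?_
      have hi' : i ≤ m := Nat.lt_succ_iff.1 (Finset.mem_range.1 hi)
      rw [Polynomial.monomial_pow, one_mul]
      conv_rhs => rw [← Nat.sub_add_cancel hi']
      rw [Polynomial.coeff_mul_monomial]
      rfl
    rw [Finset.sum_range_succ, Nat.sub_self] at hcoeff
    have hlead : P.coeff m = 1 := hP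
    rw [hlead] at hcoeff
    have h1 : ((1 : reesAlgebra I) : Polynomial R).coeff 0 = 1 := by simp
    rw [h1, one_mul] at hcoeff
    have hm1 : 1 ≤ m := by
      by_contra hlt
      have h0 : m = 0 := by omega
      rw [h0] at hcoeff
      simp at hcoeff
    refine ⟨m, hm1, fun j => (P.coeff (m - j) : Polynomial R).coeff j, fun j _ => ?_, ?_⟩
    · exact (mem_reesAlgebra_iff I _).1 (P.coeff (m - j)).2 j
    · rw [← hcoeff, add_comm]
      congr 1
      refine Finset.sum_bij' (fun j _ => m - j) (fun i _ => m - i) ?_ ?_ ?_ ?_ ?_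
      · intro j hj
        rw [Finset.mem_Icc] at hj
        rw [Finset.mem_range]; omega
      · intro i hi
        rw [Finset.mem_range] at hi
        rw [Finset.mem_Icc]; omega
      · intro j hj
        rw [Finset.mem_Icc] at hj
        omega
      · intro i hi
        rw [Finset.mem_range] at hi
        omega
      · intro j hj
        rw [Finset.mem_Icc] at hj
        rw [Nat.sub_sub_self hj.2]

/-- The integral closure of an ideal `I` of `R`: all elements of `R` that are integral over `I`. -/
def idealIntegralClosure (I : Ideal R) : Ideal R where
  carrier := {x | IsIntegralOverIdeal I x}
  zero_mem' := by
    rw [Set.mem_ofPred_eq, isIntegralOverIdeal_iff, map_zero]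
    exact isIntegral_zero
  add_mem' := by
    intro x y hx hy
    rw [Set.mem_ofPred_eq, isIntegralOverIdeal_iff] at *
    rw [map_add]
    exact hx.add hy
  smul_mem' := by
    intro r x hx
    rw [Set.mem_ofPred_eq, isIntegralOverIdeal_iff] at *
    have h : (Polynomial.monomial 1 (r • x) : Polynomial R)
        = algebraMap (reesAlgebra I) (Polynomial R) (algebraMap R (reesAlgebra I) r)
          * Polynomial.monomial 1 x := by
      rw [← IsScalarTower.algebraMap_apply, Polynomial.algebraMap_eq, Polynomial.C_mul_monomial,
        smul_eq_mul]
    rw [h]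
    exact isIntegral_algebraMap.mul hx

/-- A graded family `{aᵢ}_{i ≥ 1}` of ideals: `aₚ a_q ⊆ a_{p+q}` for `p, q ≥ 1`. The value at the
index `0` is irrelevant. -/
def IsGradedFamily (a : ℕ → Ideal R) : Prop :=
  ∀ p q : ℕ, 1 ≤ p → 1 ≤ q → a p * a q ≤ a (p + q)

/-- The asymptotic resurgence number of two families of ideals: the supremum, in the extended
reals (so `-∞` for the empty set), of all `s / r` with `s, r ≥ 1` and `a_{st} ⊄ b_{rt}` for all
sufficiently large `t`. -/
noncomputable def asympResurgence (a b : ℕ → Ideal R) : EReal :=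
  sSup {x : EReal | ∃ s r : ℕ, 1 ≤ s ∧ 1 ≤ r ∧
    (∀ᶠ t : ℕ in Filter.atTop, ¬ a (s * t) ≤ b (r * t)) ∧ x = (((s : ℝ) / (r : ℝ) : ℝ) : EReal)}

end IntegralClosure

section Monomial

variable {k : Type*} [Field k] {n : ℕ}

/-- An ideal generated by monomials. -/
def IsMonomialIdeal (I : Ideal (MvPolynomial (Fin n) k)) : Prop :=
  ∃ S : Set (Fin n →₀ ℕ), I = Ideal.span ((fun u => MvPolynomial.monomial u (1 : k)) '' S)

/-- An ideal generated by squarefree monomials. -/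
def IsSquarefreeMonomialIdeal (I : Ideal (MvPolynomial (Fin n) k)) : Prop :=
  ∃ S : Set (Fin n →₀ ℕ), (∀ u ∈ S, ∀ i, u i ≤ 1) ∧
    I = Ideal.span ((fun u => MvPolynomial.monomial u (1 : k)) '' S)

/-- The Newton polyhedron: the convex hull of the exponents of all monomials in `I`. -/
def newtonPolyhedron (I : Ideal (MvPolynomial (Fin n) k)) : Set (Fin n → ℝ) :=
  convexHull ℝ {v | ∃ u : Fin n →₀ ℕ, MvPolynomial.monomial u (1 : k) ∈ I ∧
    v = fun i => (u i : ℝ)}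

/-- The set of associated primes of (the quotient by) an ideal. -/
def assPrimes (I : Ideal (MvPolynomial (Fin n) k)) : Set (Ideal (MvPolynomial (Fin n) k)) :=
  associatedPrimes (MvPolynomial (Fin n) k) (MvPolynomial (Fin n) k ⧸ I)

/-- The symbolic polyhedron of a squarefree monomial ideal: the intersection, inside the
nonnegative orthant, of the Newton polyhedra of the associated primes. -/
def symbolicPolyhedron (I : Ideal (MvPolynomial (Fin n) k)) : Set (Fin n → ℝ) :=
  {v | (∀ i, 0 ≤ v i) ∧ ∀ p ∈ assPrimes I, v ∈ newtonPolyhedron p}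

open Classical in
/-- The Alexander dual of a squarefree monomial ideal: the ideal generated by the products
`∏_{xᵢ ∈ p} xᵢ`, one for each associated prime `p` of `I`. -/
noncomputable def alexanderDual (I : Ideal (MvPolynomial (Fin n) k)) :
    Ideal (MvPolynomial (Fin n) k) :=
  Ideal.span ((fun p : Ideal (MvPolynomial (Fin n) k) =>
    ∏ i ∈ Finset.univ.filter (fun i : Fin n => MvPolynomial.X i ∈ p), MvPolynomial.X i) ''
      assPrimes I)

/-- The Newton-Okounkov body of a graded family of monomial ideals: the closure of
`⋃_{k ≥ 1} (1 / k) NP(aₖ)`. -/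
def newtonOkounkovBody (a : ℕ → Ideal (MvPolynomial (Fin n) k)) : Set (Fin n → ℝ) :=
  closure (⋃ j : ℕ, ⋃ _ : 1 ≤ j, (1 / (j : ℝ)) • newtonPolyhedron (a j))

end Monomial

/-- The set of real `c > 0` such that `c • A` is not contained in `B`. -/
def noncontainmentSet {n : ℕ} (A B : Set (Fin n → ℝ)) : Set ℝ :=
  {c | 0 < c ∧ ¬ c • A ⊆ B}

/-- The infimum of `⟨v, w⟩` over `v ∈ A`, `w ∈ B`, for sets `A`, `B` of vectors with nonnegative
coordinates, as an element of `[0, ∞]`. -/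
noncomputable def infDot {n : ℕ} (A B : Set (Fin n → ℝ)) : ℝ≥0∞ :=
  sInf {x | ∃ v ∈ A, ∃ w ∈ B, x = ENNReal.ofReal (v ⬝ᵥ w)}

end AsympRes

/-! Everything reduces to linear programming duality. Let `S` be a set of squarefree exponents
generating `b`; it is finite. By convex separation NP(b) is cut out of the orthant by the
inequalities `1 ≤ v ⬝ᵥ w` with `w ∈ blocker S` (`mem_newtonPolyhedron_span_iff`). So `c • Δ ⊄ NP(b)`
means `c * (v ⬝ᵥ w) < 1` for some `v ∈ Δ`, `w ∈ blocker S`, and the supremum of such `c` is the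
reciprocal of the infimum of the pairings. The blocker is SP(b^∨), because supports of generators
and coordinate primes are transversals of each other (`symbolicPolyhedron_alexanderDual`).

The resurgence enters through integral closures of powers. A weight `w` in the blocker is at least
`m` on every monomial integral over `b ^ m` (`le_of_monomial_mem_integralClosure`). Conversely, an
exponent strictly inside `m • NP(b)`, in the sense of a factor `θ < 1`, is integral over `b ^ m`
(`monomial_mem_integralClosure`). The loss of `θ` does not affect a supremum. -/

namespace AsympRes

/-! ### Associated primes of squarefree monomial ideals -/

section SquarefreePrimes

open MvPolynomial

variable {k : Type*} [Field k] {n : ℕ}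

/-- The prime ideal generated by the variables indexed by `C`. -/
noncomputable def coordIdeal (k : Type*) [Field k] {n : ℕ} (C : Set (Fin n)) :
    Ideal (MvPolynomial (Fin n) k) :=
  Ideal.span (X '' C)

/-- `C` meets the support of every exponent in `S`. -/
def IsCover (S : Set (Fin n →₀ ℕ)) (C : Set (Fin n)) : Prop :=
  ∀ u ∈ S, ∃ i ∈ C, u i ≠ 0

theorem mem_coordIdeal {C : Set (Fin n)} {f : MvPolynomial (Fin n) k} :
    f ∈ coordIdeal k C ↔ ∀ u ∈ f.support, ∃ i ∈ C, u i ≠ 0 :=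
  mem_ideal_span_X_image

theorem monomial_mem_coordIdeal {C : Set (Fin n)} {u : Fin n →₀ ℕ} :
    monomial u (1 : k) ∈ coordIdeal k C ↔ ∃ i ∈ C, u i ≠ 0 := by
  classical
  rw [mem_coordIdeal, support_monomial, if_neg one_ne_zero]
  simp

theorem X_mem_coordIdeal {C : Set (Fin n)} {i : Fin n} :
    (X i : MvPolynomial (Fin n) k) ∈ coordIdeal k C ↔ i ∈ C := by
  refine monomial_mem_coordIdeal.trans ⟨?_, fun h => ⟨i, h, by simp⟩⟩
  rintro ⟨j, hj, hij⟩
  by_cases h : i = j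
  · exact h ▸ hj
  · simp [h] at hij

/-- The ideal is the kernel of the substitution killing the variables in `C`, a map into a domain;
modulo the ideal this substitution is the identity. -/
theorem coordIdeal_isPrime (C : Set (Fin n)) : (coordIdeal k C).IsPrime := by
  classical
  let φ : MvPolynomial (Fin n) k →ₐ[k] MvPolynomial (Fin n) k :=
    aeval fun i => if i ∈ C then 0 else X i
  have h : coordIdeal k C = RingHom.ker φ := by
    apply le_antisymm
    · refine Ideal.span_le.2 ?_
      rintro _ ⟨i, hi, rfl⟩
      simp [φ, RingHom.mem_ker, hi]
    · intro f hf
      have hmk : (Ideal.Quotient.mkₐ k (coordIdeal k C)).comp φ =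
          Ideal.Quotient.mkₐ k (coordIdeal k C) := by
        refine algHom_ext fun i => ?_
        by_cases hi : i ∈ C
        · simpa [φ, hi] using (Ideal.Quotient.eq_zero_iff_mem.2 (X_mem_coordIdeal.2 hi)).symm
        · simp [φ, hi]
      have h2 := DFunLike.congr_fun hmk f
      rw [AlgHom.comp_apply, (RingHom.mem_ker).1 hf, map_zero] at h2
      exact Ideal.Quotient.eq_zero_iff_mem.1 h2.symm
  rw [h]
  exact RingHom.ker_isPrime _

theorem monomial_mem_span {S : Set (Fin n →₀ ℕ)} {u : Fin n →₀ ℕ} :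
    monomial u (1 : k) ∈ Ideal.span ((fun u => monomial u (1 : k)) '' S) ↔ ∃ s ∈ S, s ≤ u := by
  classical
  rw [mem_ideal_span_monomial_image, support_monomial, if_neg one_ne_zero]
  simp

theorem span_monomial_le_coordIdeal {S : Set (Fin n →₀ ℕ)} {C : Set (Fin n)} :
    Ideal.span ((fun u => monomial u (1 : k)) '' S) ≤ coordIdeal k C ↔ IsCover S C := by
  rw [Ideal.span_le, Set.image_subset_iff]
  exact forall₂_congr fun u _ => monomial_mem_coordIdeal

/-- A squarefree monomial ideal is the intersection of the coordinate primes containing it. -/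
theorem mem_span_squarefree_iff {S : Set (Fin n →₀ ℕ)} (hS : ∀ u ∈ S, ∀ i, u i ≤ 1)
    {f : MvPolynomial (Fin n) k} :
    f ∈ Ideal.span ((fun u => monomial u (1 : k)) '' S) ↔
      ∀ C, IsCover S C → f ∈ coordIdeal k C := by
  refine ⟨fun hf C hC => span_monomial_le_coordIdeal.2 hC hf, fun h => ?_⟩
  rw [mem_ideal_span_monomial_image]
  intro e he
  by_contra! hne
  -- A squarefree generator that misses the zero set of `e` would divide the monomial of `e`.
  have hcov : IsCover S {i | e i = 0} := by
    intro u hu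
    have := hne u hu
    rw [Finsupp.le_def, not_forall] at this
    obtain ⟨i, hi⟩ := this
    have := hS u hu i
    exact ⟨i, by rw [Set.mem_ofPred_eq]; omega, by omega⟩
  obtain ⟨i, hi, hi'⟩ := mem_coordIdeal.1 (h _ hcov) e he
  exact hi' hi

/-- The colon ideal `I : f` contains the intersection of the finitely many coordinate primes over
`I` that avoid `f`, and lies in each of them. A prime equal to its radical therefore contains, and
then equals, one of them. -/
theorem exists_isCover_of_mem_assPrimes {S : Set (Fin n →₀ ℕ)} (hS : ∀ u ∈ S, ∀ i, u i ≤ 1)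
    {p : Ideal (MvPolynomial (Fin n) k)}
    (hp : p ∈ assPrimes (Ideal.span ((fun u => monomial u (1 : k)) '' S))) :
    ∃ C, IsCover S C ∧ p = coordIdeal k C := by
  classical
  set I := Ideal.span ((fun u => monomial u (1 : k)) '' S) with hI
  obtain ⟨hprime, x, hx⟩ := hp
  obtain ⟨f, rfl⟩ := Ideal.Quotient.mk_surjective x
  have hmem : ∀ g, g ∈ Submodule.colon (⊥ : Submodule (MvPolynomial (Fin n) k)
      (MvPolynomial (Fin n) k ⧸ I)) {Ideal.Quotient.mk I f} ↔ g * f ∈ I := by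
    intro g
    rw [Submodule.mem_colon_singleton, Submodule.mem_bot, ← Ideal.Quotient.eq_zero_iff_mem,
      map_mul]
    rfl
  let T : Finset (Set (Fin n)) :=
    Finset.univ.filter fun C => IsCover S C ∧ f ∉ coordIdeal k C
  have hT : T.inf (coordIdeal k) ≤ p := by
    intro g hg
    rw [hx]
    refine Ideal.le_radical ((hmem g).2 ?_)
    rw [hI, mem_span_squarefree_iff hS]
    intro C hC
    by_cases hf : f ∈ coordIdeal k C
    · exact Ideal.mul_mem_left _ _ hf
    · refine Ideal.mul_mem_right _ _ ?_
      rw [Submodule.mem_finsetInf] at hg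
      exact hg C (by simp [T, hC, hf])
  obtain ⟨C, hC, hCp⟩ := hprime.inf_le'.1 hT
  simp only [T, Finset.mem_filter, Finset.mem_univ, true_and] at hC
  refine ⟨C, hC.1, le_antisymm (fun g hg => ?_) hCp⟩
  rw [hx] at hg
  obtain ⟨m, hm⟩ := hg
  have := span_monomial_le_coordIdeal.2 hC.1 ((hmem _).1 hm)
  have hP := coordIdeal_isPrime (k := k) C
  exact hP.mem_of_pow_mem m ((hP.mem_or_mem this).resolve_right hC.2)

theorem exists_mem_assPrimes_of_isCover {S : Set (Fin n →₀ ℕ)} (hS : ∀ u ∈ S, ∀ i, u i ≤ 1)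
    {C : Set (Fin n)} (hC : IsCover S C) :
    ∃ D ⊆ C, coordIdeal k D ∈ assPrimes (Ideal.span ((fun u => monomial u (1 : k)) '' S)) := by
  have := coordIdeal_isPrime (k := k) C
  obtain ⟨p, hp, hpC⟩ := Ideal.exists_minimalPrimes_le
    (span_monomial_le_coordIdeal (k := k).2 hC)
  have hp' : p ∈ assPrimes (Ideal.span ((fun u => monomial u (1 : k)) '' S)) := by
    apply Module.associatedPrimes.minimalPrimes_annihilator_subset_associatedPrimes
    rwa [Ideal.annihilator_quotient]
  obtain ⟨D, -, rfl⟩ := exists_isCover_of_mem_assPrimes hS hp'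
  exact ⟨D, fun i hi => X_mem_coordIdeal.1 (hpC (X_mem_coordIdeal.2 hi)), hp'⟩

/-- The exponents of the standard generators of the Alexander dual. -/
def dualExponents (I : Ideal (MvPolynomial (Fin n) k)) : Set (Fin n →₀ ℕ) :=
  {u | ∃ C, coordIdeal k C ∈ assPrimes I ∧ (∀ i, u i ≤ 1) ∧ ∀ i, u i ≠ 0 ↔ i ∈ C}

/-- Exhibits squarefree generators, so that the description of associated primes applies to the dual
as well. -/
theorem alexanderDual_eq_span {S : Set (Fin n →₀ ℕ)} (hS : ∀ u ∈ S, ∀ i, u i ≤ 1) :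
    alexanderDual (Ideal.span ((fun u => monomial u (1 : k)) '' S)) =
      Ideal.span ((fun u => monomial u (1 : k)) ''
        dualExponents (Ideal.span ((fun u => monomial u (1 : k)) '' S))) := by
  classical
  have key : ∀ s : Finset (Fin n), (∏ i ∈ s, X i : MvPolynomial (Fin n) k) =
      monomial (Finsupp.indicator s fun _ _ => 1) 1 := by
    intro s
    have h1 : Finsupp.indicator s (fun _ _ => 1) = ∑ i ∈ s, Finsupp.single i 1 := by
      ext j
      simp [Finsupp.indicator_apply, Finsupp.single_apply, Finsupp.finsetSum_apply]
    rw [h1, monomial_sum_one]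
    rfl
  unfold alexanderDual
  congr 1
  ext f
  constructor
  · rintro ⟨p, hp, rfl⟩
    obtain ⟨C, hC, rfl⟩ := exists_isCover_of_mem_assPrimes hS hp
    refine ⟨Finsupp.indicator
      (Finset.univ.filter fun i : Fin n => X i ∈ coordIdeal k C) fun _ _ => 1,
      ⟨C, hp, fun i => ?_, fun i => ?_⟩, (key _).symm⟩
    · rw [Finsupp.indicator_apply]
      split_ifs <;> simp
    · simp [Finsupp.indicator_apply, X_mem_coordIdeal]
  · rintro ⟨u, ⟨C, hC, hu1, hu⟩, rfl⟩
    refine ⟨_, hC, (key _).trans ?_⟩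
    refine congrArg (fun u => monomial u (1 : k)) (Finsupp.ext fun i => ?_)
    have h1 := hu1 i
    have h2 := hu i
    by_cases hi : i ∈ C
    · have := h2.2 hi
      simp [Finsupp.indicator_apply, X_mem_coordIdeal, hi]
      omega
    · have : u i = 0 := by tauto
      simp [Finsupp.indicator_apply, X_mem_coordIdeal, hi, this]

end SquarefreePrimes

end AsympRes

namespace AsympRes

/-! ### Newton polyhedra and blocking duality -/

section Blocker

open MvPolynomial

variable {k : Type*} [Field k] {n : ℕ}

/-- The real vector of an exponent. -/
def expVec (u : Fin n →₀ ℕ) : Fin n → ℝ := fun i => (u i : ℝ)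

@[simp] theorem expVec_add (u v : Fin n →₀ ℕ) : expVec (u + v) = expVec u + expVec v := by
  ext i; simp [expVec]

@[simp] theorem expVec_nsmul (m : ℕ) (u : Fin n →₀ ℕ) :
    expVec (m • u) = (m : ℝ) • expVec u := by
  ext i; simp [expVec]

theorem expVec_nonneg (u : Fin n →₀ ℕ) : 0 ≤ expVec u := fun i => Nat.cast_nonneg (u i)

/-- The nonnegative vectors whose pairing with each exponent in `S` is at least `1`. -/
def blocker (S : Set (Fin n →₀ ℕ)) : Set (Fin n → ℝ) :=
  {w | 0 ≤ w ∧ ∀ u ∈ S, 1 ≤ expVec u ⬝ᵥ w}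

theorem convexHull_range_expVec :
    convexHull ℝ (Set.range (expVec (n := n))) = Set.Ici 0 := by
  apply le_antisymm
  · refine convexHull_min ?_ (convex_Ici 0)
    rintro _ ⟨u, rfl⟩
    exact expVec_nonneg u
  · intro v hv
    have h : Set.range (expVec (n := n)) =
        Set.univ.pi fun _ : Fin n => Set.range ((↑) : ℕ → ℝ) := by
      ext x
      constructor
      · rintro ⟨u, rfl⟩ i -
        exact ⟨u i, rfl⟩
      · intro hx
        choose f hf using fun i => hx i trivial
        exact ⟨Finsupp.equivFunOnFinite.symm f, funext hf⟩
    rw [h, convexHull_pi]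
    intro i _
    obtain ⟨N, hN⟩ := exists_nat_ge (v i)
    have h0 : (0 : ℝ) ∈ Set.range ((↑) : ℕ → ℝ) := ⟨0, Nat.cast_zero⟩
    have h1 : (N : ℝ) ∈ Set.range ((↑) : ℕ → ℝ) := ⟨N, rfl⟩
    refine segment_subset_convexHull h0 h1 ?_
    rw [segment_eq_Icc (Nat.cast_nonneg N)]
    exact ⟨hv i, hN⟩

/-- The exponents occurring are `S + ℕⁿ`, and convex hulls commute with Minkowski sums. -/
theorem newtonPolyhedron_span (S : Set (Fin n →₀ ℕ)) :
    newtonPolyhedron (Ideal.span ((fun u => monomial u (1 : k)) '' S)) =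
      convexHull ℝ (expVec '' S) + Set.Ici 0 := by
  rw [← convexHull_range_expVec, ← convexHull_add]
  unfold newtonPolyhedron
  congr 1
  ext v
  constructor
  · rintro ⟨u, hu, rfl⟩
    obtain ⟨s, hs, hsu⟩ := monomial_mem_span.1 hu
    refine ⟨expVec s, ⟨s, hs, rfl⟩, expVec (u - s), ⟨_, rfl⟩, ?_⟩
    change expVec s + expVec (u - s) = expVec u
    rw [← expVec_add, add_tsub_cancel_of_le hsu]
  · rintro ⟨_, ⟨s, hs, rfl⟩, _, ⟨t, rfl⟩, rfl⟩
    exact ⟨s + t, monomial_mem_span.2 ⟨s, hs, le_self_add⟩, (expVec_add s t).symm⟩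

theorem newtonPolyhedron_nonneg (I : Ideal (MvPolynomial (Fin n) k)) :
    newtonPolyhedron I ⊆ Set.Ici 0 := by
  refine convexHull_min ?_ (convex_Ici (𝕜 := ℝ) 0)
  rintro _ ⟨u, -, rfl⟩
  exact expVec_nonneg u

theorem isClosed_newtonPolyhedron_span {S : Set (Fin n →₀ ℕ)} (hS : S.Finite) :
    IsClosed (newtonPolyhedron (Ideal.span ((fun u => monomial u (1 : k)) '' S))) := by
  rw [newtonPolyhedron_span]
  exact isClosed_Ici.add_left_of_isCompact ((hS.image expVec).isCompact_convexHull (𝕜 := ℝ))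

/-- The Newton polyhedron of a finitely generated monomial ideal is its double blocker. -/
theorem mem_newtonPolyhedron_span_iff {S : Set (Fin n →₀ ℕ)} (hS : S.Finite)
    {v : Fin n → ℝ} :
    v ∈ newtonPolyhedron (Ideal.span ((fun u => monomial u (1 : k)) '' S)) ↔
      0 ≤ v ∧ ∀ w ∈ blocker S, 1 ≤ v ⬝ᵥ w := by
  refine ⟨fun hv => ⟨newtonPolyhedron_nonneg _ hv, fun w hw => ?_⟩, fun ⟨hv0, hv⟩ => ?_⟩
  · rw [newtonPolyhedron_span] at hv
    obtain ⟨x, hx, y, hy, rfl⟩ := hv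
    have hconv : Convex ℝ {x : Fin n → ℝ | 1 ≤ x ⬝ᵥ w} :=
      convex_halfSpace_ge (f := fun x : Fin n → ℝ => x ⬝ᵥ w)
        ⟨fun a b => add_dotProduct a b w, fun c a => smul_dotProduct c a w⟩ 1
    have h1 : 1 ≤ x ⬝ᵥ w := by
      refine convexHull_min ?_ hconv hx
      rintro _ ⟨u, hu, rfl⟩
      exact hw.2 u hu
    have h2 : 0 ≤ y ⬝ᵥ w := dotProduct_nonneg_of_nonneg hy hw.1
    change 1 ≤ (x + y) ⬝ᵥ w
    rw [add_dotProduct]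
    linarith
  · by_contra hvn
    rcases S.eq_empty_or_nonempty with rfl | ⟨u, hu⟩
    · have := hv 0 ⟨le_rfl, by simp⟩
      simp at this
      linarith
    obtain ⟨f, c, hfv, hf⟩ := geometric_hahn_banach_point_closed
      (convex_convexHull ℝ _) (isClosed_newtonPolyhedron_span (k := k) hS) hvn
    set w : Fin n → ℝ := fun i => f (Pi.single i 1) with hw
    have hfw : ∀ x, f x = x ⬝ᵥ w := by
      intro x
      conv_lhs => rw [pi_eq_sum_univ' x]
      rw [map_sum]
      simp only [map_smul, smul_eq_mul, dotProduct, hw]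
    have hmem : ∀ u ∈ S, ∀ y : Fin n → ℝ, 0 ≤ y → c < (expVec u + y) ⬝ᵥ w := by
      intro u hu y hy
      rw [← hfw]
      apply hf
      have : expVec u + y ∈ newtonPolyhedron (Ideal.span ((fun u => monomial u (1 : k)) '' S)) := by
        rw [newtonPolyhedron_span]
        exact Set.add_mem_add (subset_convexHull ℝ _ ⟨u, hu, rfl⟩) hy
      exact this
    -- A negative coordinate would make the functional unbounded below along a ray of the orthant.
    have hw0 : 0 ≤ w := by
      intro i
      by_contra! hi
      have hi' : w i < 0 := hi
      obtain ⟨N, hN⟩ := exists_nat_gt ((expVec u ⬝ᵥ w - c) / (-w i))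
      have := hmem u hu (Pi.single i (N : ℝ)) (by
        rw [Pi.single_nonneg]; positivity)
      rw [add_dotProduct, single_dotProduct] at this
      rw [div_lt_iff₀ (by linarith)] at hN
      linarith
    have hvw : 0 ≤ v ⬝ᵥ w := dotProduct_nonneg_of_nonneg hv0 hw0
    rw [hfw] at hfv
    -- Positivity of the separating level allows rescaling `w` into the blocker.
    have hc : 0 < c := by linarith
    have := hv (c⁻¹ • w) ⟨smul_nonneg (by positivity) hw0, fun u hu => by
      have := hmem u hu 0 le_rfl
      rw [add_zero] at this
      rw [dotProduct_smul, smul_eq_mul, ← div_eq_inv_mul, le_div_iff₀ hc]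
      linarith⟩
    rw [dotProduct_smul, smul_eq_mul, ← div_eq_inv_mul, le_div_iff₀ hc] at this
    linarith

/-- The indicator of `C` is the least element of the blocker of the unit vectors in `C`, so it is
the only weight to test. -/
theorem newtonPolyhedron_coordIdeal (C : Set (Fin n)) {v : Fin n → ℝ} :
    v ∈ newtonPolyhedron (coordIdeal k C) ↔ 0 ≤ v ∧ 1 ≤ v ⬝ᵥ C.indicator 1 := by
  have h : coordIdeal k C = Ideal.span ((fun u => monomial u (1 : k)) ''
      ((fun i => Finsupp.single i 1) '' C)) := by
    rw [Set.image_image]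
    rfl
  rw [h, mem_newtonPolyhedron_span_iff ((Set.toFinite C).image _)]
  have hvec : ∀ i, expVec (Finsupp.single i 1 : Fin n →₀ ℕ) = Pi.single i (1 : ℝ) := by
    intro i
    ext j
    by_cases hij : i = j
    · subst hij; simp [expVec]
    · simp [expVec, Ne.symm hij]
  refine and_congr_right fun hv => ⟨fun h => h _ ⟨?_, ?_⟩, fun h w hw => ?_⟩
  · exact Set.indicator_nonneg fun _ _ => zero_le_one
  · rintro _ ⟨i, hi, rfl⟩
    simp [hvec, hi]
  · refine h.trans (dotProduct_le_dotProduct_of_nonneg_left (fun i => ?_) hv)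
    by_cases hi : i ∈ C
    · have := hw.2 _ ⟨i, hi, rfl⟩
      simpa [hvec, hi] using this
    · simpa [hi] using hw.1 i

/-- The support of each `u ∈ S` contains some `D` with `coordIdeal k D` associated to the dual, and
each such `D` contains the support of some `u ∈ S`. For `w ≥ 0` the two systems of inequalities then
imply each other. -/
theorem symbolicPolyhedron_alexanderDual {S : Set (Fin n →₀ ℕ)} (hS : ∀ u ∈ S, ∀ i, u i ≤ 1) :
    symbolicPolyhedron (alexanderDual (Ideal.span ((fun u => monomial u (1 : k)) '' S))) =
      blocker S := by
  rw [alexanderDual_eq_span hS]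
  set T := dualExponents (Ideal.span ((fun u => monomial u (1 : k)) '' S))
  have hT : ∀ u ∈ T, ∀ i, u i ≤ 1 := by
    rintro u ⟨C, -, h, -⟩
    exact h
  have hle : ∀ (C : Set (Fin n)) (u : Fin n →₀ ℕ) (w : Fin n → ℝ), 0 ≤ w →
      (∀ i, u i ≤ 1) → (∀ i, u i ≠ 0 → i ∈ C) →
      expVec u ⬝ᵥ w ≤ w ⬝ᵥ C.indicator 1 := by
    intro C u w hw hu1 hu
    rw [dotProduct_comm w]
    refine dotProduct_le_dotProduct_of_nonneg_right (fun i => ?_) hw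
    by_cases hi : u i = 0
    · have : 0 ≤ C.indicator (1 : Fin n → ℝ) i := Set.indicator_nonneg (fun _ _ => zero_le_one) i
      simpa [expVec, hi] using this
    · simpa [hu i hi, expVec] using hu1 i
  ext w
  constructor
  · rintro ⟨hw, hp⟩
    refine ⟨hw, fun u hu => ?_⟩
    have hcov : IsCover T {i | u i ≠ 0} := by
      rintro t ⟨C, hC, -, ht⟩
      obtain ⟨C', hC', hCC'⟩ := exists_isCover_of_mem_assPrimes hS hC
      have : C = C' := by
        ext i
        rw [← X_mem_coordIdeal (k := k), hCC', X_mem_coordIdeal]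
      subst this
      obtain ⟨i, hi, hui⟩ := hC' u hu
      exact ⟨i, hui, (ht i).2 hi⟩
    obtain ⟨D, hD, hDass⟩ := exists_mem_assPrimes_of_isCover (k := k) hT hcov
    have := ((newtonPolyhedron_coordIdeal D).1 (hp _ hDass)).2
    rw [dotProduct_comm] at this
    refine this.trans (dotProduct_le_dotProduct_of_nonneg_right (fun i => ?_) hw)
    by_cases hi : i ∈ D
    · have h1 : 1 ≤ u i := Nat.one_le_iff_ne_zero.2 (hD hi)
      simpa [hi, expVec] using h1
    · simpa [hi] using expVec_nonneg u i
  · rintro ⟨hw, hu⟩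
    refine ⟨hw, fun p hp => ?_⟩
    obtain ⟨D, hD, rfl⟩ := exists_isCover_of_mem_assPrimes hT hp
    refine (newtonPolyhedron_coordIdeal D).2 ⟨hw, ?_⟩
    -- Otherwise `Dᶜ` covers `S`, hence contains an associated `C`; then `D` misses the dual
    -- generator supported on `C`.
    obtain ⟨u, huS, huD⟩ : ∃ u ∈ S, ∀ i, u i ≠ 0 → i ∈ D := by
      by_contra! hne
      have hcov : IsCover S Dᶜ := by
        intro u hu
        obtain ⟨i, hi, hiD⟩ := hne u hu
        exact ⟨i, hiD, hi⟩
      obtain ⟨C, hC, hCass⟩ := exists_mem_assPrimes_of_isCover (k := k) hS hcov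
      classical
      obtain ⟨i, hi, hi'⟩ := hD (Finsupp.indicator (Finset.univ.filter (· ∈ C)) fun _ _ => 1)
        ⟨C, hCass, fun i => by rw [Finsupp.indicator_apply]; split_ifs <;> simp,
          fun i => by simp [Finsupp.indicator_apply]⟩
      have : i ∈ C := by
        by_contra hiC
        simp [Finsupp.indicator_apply, hiC] at hi'
      exact hC this hi
    exact (hu u huS).trans (hle D u w hw (hS u huS) huD)

end Blocker

end AsympRes

namespace AsympRes

/-! ### Monomials in integral closures of powers -/

section IntegralMonomials

open MvPolynomial

variable {k : Type*} [Field k] {n : ℕ}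

theorem le_of_mem_span_pow {S : Set (Fin n →₀ ℕ)} {w : Fin n → ℝ} (hw : w ∈ blocker S) (q : ℕ) :
    ∀ f ∈ (Ideal.span ((fun u => monomial u (1 : k)) '' S)) ^ q, ∀ u ∈ f.support,
      (q : ℝ) ≤ expVec u ⬝ᵥ w := by
  classical
  induction q with
  | zero =>
    intro f _ u _
    simpa using dotProduct_nonneg_of_nonneg (expVec_nonneg u) hw.1
  | succ q ih =>
    intro f hf
    rw [pow_succ] at hf
    refine Submodule.mul_induction_on hf ?_ ?_
    · intro g hg h hh u hu
      obtain ⟨x, hx, y, hy, rfl⟩ := Finset.mem_add.1 (support_mul g h hu)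
      obtain ⟨s, hs, hsy⟩ := mem_ideal_span_monomial_image.1 hh y hy
      have h1 := ih g hg x hx
      have h2 : expVec s ⬝ᵥ w ≤ expVec y ⬝ᵥ w :=
        dotProduct_le_dotProduct_of_nonneg_right (fun i => Nat.cast_le.2 (hsy i)) hw.1
      have h3 := hw.2 s hs
      rw [expVec_add, add_dotProduct]
      push_cast
      linarith
    · intro g h hg hh u hu
      rcases Finset.mem_union.1 (support_add hu) with h' | h'
      · exact hg u h'
      · exact hh u h'

/-- In the integral equation the monomial of `N • u` must cancel against some `c j * x ^ (N - j)`.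
So `j • u` occurs in `c j`, an element of the `m * j`-th power, and has weight at least `m * j`. -/
theorem le_of_monomial_mem_integralClosure {S : Set (Fin n →₀ ℕ)} {w : Fin n → ℝ}
    (hw : w ∈ blocker S) {m : ℕ} {u : Fin n →₀ ℕ}
    (hu : monomial u (1 : k) ∈
      idealIntegralClosure ((Ideal.span ((fun u => monomial u (1 : k)) '' S)) ^ m)) :
    (m : ℝ) ≤ expVec u ⬝ᵥ w := by
  classical
  obtain ⟨N, -, c, hc, h⟩ := hu
  have hcoeff := congrArg (coeff (N • u)) h
  rw [monomial_pow, one_pow, coeff_add, coeff_monomial, if_pos rfl, coeff_zero, coeff_sum] at hcoeff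
  obtain ⟨j, hj, hne⟩ : ∃ j ∈ Finset.Icc 1 N,
      coeff (N • u) (c j * monomial u (1 : k) ^ (N - j)) ≠ 0 := by
    by_contra! hall
    rw [Finset.sum_eq_zero hall] at hcoeff
    simp at hcoeff
  have hj' := Finset.mem_Icc.1 hj
  have hN : N • u = j • u + (N - j) • u := by
    rw [← add_smul, Nat.add_sub_cancel' hj'.2]
  rw [monomial_pow, one_pow, hN, coeff_mul_monomial, mul_one] at hne
  have hcj := hc j hj
  rw [← pow_mul] at hcj
  have := le_of_mem_span_pow hw _ _ hcj _ (mem_support_iff.2 hne)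
  rw [expVec_nsmul, smul_dotProduct, smul_eq_mul, Nat.cast_mul, mul_comm] at this
  exact le_of_mul_le_mul_left this (by exact_mod_cast hj'.1)

theorem mem_integralClosure_of_pow_mem {R : Type*} [CommRing R] {I : Ideal R} {x : R} {N : ℕ}
    (hN : 1 ≤ N) (hx : x ^ N ∈ I ^ N) : x ∈ idealIntegralClosure I := by
  refine ⟨N, hN, fun j => if j = N then -x ^ N else 0, fun j _ => ?_, ?_⟩
  · dsimp only
    split_ifs with h
    · rw [h]
      exact neg_mem hx
    · exact zero_mem _
  · rw [Finset.sum_eq_single N]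
    · simp
    · intro j _ hj
      simp [hj]
    · intro h
      exact absurd (Finset.mem_Icc.2 ⟨hN, le_rfl⟩) h

theorem monomial_sum_mem_pow {S : Set (Fin n →₀ ℕ)} {ι : Type*} (s : Finset ι)
    (z : ι → Fin n →₀ ℕ) (hz : ∀ i, z i ∈ S) (c : ι → ℕ) :
    monomial (∑ i ∈ s, c i • z i) (1 : k) ∈
      (Ideal.span ((fun u => monomial u (1 : k)) '' S)) ^ (∑ i ∈ s, c i) := by
  classical
  rw [monomial_sum_one, ← Finset.prod_pow_eq_pow_sum]
  refine Ideal.prod_mem_prod fun i _ => ?_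
  have hzi : monomial (z i) (1 : k) ∈ Ideal.span ((fun u => monomial u (1 : k)) '' S) :=
    Ideal.subset_span ⟨z i, hz i, rfl⟩
  have := Ideal.pow_mem_pow hzi (c i)
  rwa [monomial_pow, one_pow] at this

/-- Scaling a convex combination below `(θ / m) • expVec u` by `N * (m / θ)` bounds `N • u` from
below with total coefficient `N * (m / θ)`. Rounding the coefficients down costs at most one per
term, which the slack from `θ < 1` absorbs for large `N`; hence the `N`-th power of the monomial
lies in the `m * N`-th power of the ideal. -/
theorem monomial_mem_integralClosure {S : Set (Fin n →₀ ℕ)} {m : ℕ} (hm : 1 ≤ m)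
    {u : Fin n →₀ ℕ} {θ : ℝ} (hθ0 : 0 < θ) (hθ1 : θ < 1)
    (hu : (θ / m) • expVec u ∈
      newtonPolyhedron (Ideal.span ((fun u => monomial u (1 : k)) '' S))) :
    monomial u (1 : k) ∈
      idealIntegralClosure ((Ideal.span ((fun u => monomial u (1 : k)) '' S)) ^ m) := by
  rw [newtonPolyhedron_span] at hu
  obtain ⟨x, hx, y, hy, hxy⟩ := hu
  obtain ⟨ι, _, l, z, hl0, hl1, hz, rfl⟩ := mem_convexHull_iff_exists_fintype.1 hx
  choose t htS ht using hz
  have hm0 : (0 : ℝ) < m := by exact_mod_cast hm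
  have hgap : 0 < m / θ - m := by
    rw [sub_pos, lt_div_iff₀ hθ0]
    nlinarith
  -- `N * (m / θ - m)` must exceed the number of terms rounded.
  obtain ⟨N, hN⟩ := exists_nat_gt ((Fintype.card ι : ℝ) / (m / θ - m))
  have hN0 : (0 : ℝ) < N := lt_of_le_of_lt (by positivity) hN
  rw [div_lt_iff₀ hgap] at hN
  set c : ι → ℕ := fun i => ⌊N * (m / θ) * l i⌋₊ with hc
  have hsum : m * N ≤ ∑ i, c i := by
    have h1 : ∀ i, N * (m / θ) * l i - 1 ≤ (c i : ℝ) := fun i => (Nat.sub_one_lt_floor _).le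
    have h2 := Finset.sum_le_sum fun i (_ : i ∈ Finset.univ) => h1 i
    rw [Finset.sum_sub_distrib, ← Finset.mul_sum, hl1] at h2
    simp only [Finset.sum_const, Finset.card_univ, nsmul_eq_mul, mul_one] at h2
    have h3 : ((m * N : ℕ) : ℝ) ≤ ((∑ i, c i : ℕ) : ℝ) := by
      push_cast
      linarith
    exact_mod_cast h3
  have hle : ∑ i, c i • t i ≤ N • u := by
    intro j
    have h1 : ((∑ i, c i • t i : Fin n →₀ ℕ) j : ℝ) = ∑ i, (c i : ℝ) * t i j := by
      rw [Finsupp.finsetSum_apply]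
      simp
    have h2 : ∑ i, (c i : ℝ) * t i j ≤ ∑ i, N * (m / θ) * l i * t i j := by
      refine Finset.sum_le_sum fun i _ => mul_le_mul_of_nonneg_right ?_ (Nat.cast_nonneg _)
      exact Nat.floor_le (mul_nonneg (by positivity) (hl0 i))
    have h3 : ∑ i, l i * t i j ≤ θ / m * u j := by
      have := congrFun hxy j
      simp only [← ht, Pi.add_apply, Finset.sum_apply, Pi.smul_apply, smul_eq_mul, expVec] at this
      have hyj : 0 ≤ y j := hy j
      linarith
    have h4 : ∑ i, N * (m / θ) * l i * t i j = N * (m / θ) * ∑ i, l i * t i j := by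
      rw [Finset.mul_sum]
      exact Finset.sum_congr rfl fun i _ => by ring
    have h5 : N * (m / θ) * ∑ i, l i * t i j ≤ N * (m / θ) * (θ / m * u j) :=
      mul_le_mul_of_nonneg_left h3 (by positivity)
    have h6 : N * (m / θ) * (θ / m * u j) = N * u j := by
      field_simp
    have h7 : ((∑ i, c i • t i : Fin n →₀ ℕ) j : ℝ) ≤ ((N • u) j : ℕ) := by
      rw [Finsupp.smul_apply, smul_eq_mul, Nat.cast_mul]
      linarith
    exact_mod_cast h7
  refine mem_integralClosure_of_pow_mem (N := N) (by exact_mod_cast hN0) ?_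
  rw [← pow_mul, monomial_pow, one_pow]
  have h8 := Ideal.pow_le_pow_right hsum
    (monomial_sum_mem_pow (k := k) Finset.univ t htS c)
  have h9 : monomial (N • u) (1 : k) =
      monomial (N • u - ∑ i, c i • t i) 1 * monomial (∑ i, c i • t i) 1 := by
    rw [monomial_mul, one_mul, tsub_add_cancel_of_le hle]
  rw [h9]
  exact Ideal.mul_mem_left _ _ h8

theorem exists_monomial_of_not_le {I J : Ideal (MvPolynomial (Fin n) k)} (hI : IsMonomialIdeal I)
    (h : ¬ I ≤ J) : ∃ u, monomial u (1 : k) ∈ I ∧ monomial u (1 : k) ∉ J := by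
  obtain ⟨S, rfl⟩ := hI
  by_contra! hall
  refine h (Ideal.span_le.2 ?_)
  rintro _ ⟨u, hu, rfl⟩
  exact hall u (Ideal.subset_span ⟨u, hu, rfl⟩)

theorem IsGradedFamily.pow_mem {R : Type*} [CommRing R] {a : ℕ → Ideal R} (ha : IsGradedFamily a)
    {j : ℕ} (hj : 1 ≤ j) {x : R} (hx : x ∈ a j) {t : ℕ} (ht : 1 ≤ t) : x ^ t ∈ a (j * t) := by
  induction t, ht using Nat.le_induction with
  | base => simpa using hx
  | succ t ht ih =>
    rw [pow_succ, mul_add, mul_one]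
    exact ha _ _ (Nat.mul_pos hj ht) hj (Ideal.mul_mem_mul ih hx)

end IntegralMonomials

end AsympRes

namespace AsympRes

/-! ### Comparison of the three suprema -/

section NoncontainmentThreshold

open MvPolynomial

variable {k : Type*} [Field k] {n : ℕ}

theorem newtonOkounkovBody_nonneg (a : ℕ → Ideal (MvPolynomial (Fin n) k)) :
    newtonOkounkovBody a ⊆ Set.Ici 0 := by
  refine closure_minimal ?_ isClosed_Ici
  refine Set.iUnion₂_subset fun j _ => ?_
  rintro _ ⟨v, hv, rfl⟩
  have hv0 : 0 ≤ v := newtonPolyhedron_nonneg _ hv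
  have hj0 : 0 ≤ 1 / (j : ℝ) := by positivity
  exact smul_nonneg hj0 hv0

theorem smul_expVec_mem_newtonOkounkovBody {a : ℕ → Ideal (MvPolynomial (Fin n) k)} {j : ℕ}
    (hj : 1 ≤ j) {u : Fin n →₀ ℕ} (hu : monomial u (1 : k) ∈ a j) :
    (1 / (j : ℝ)) • expVec u ∈ newtonOkounkovBody a :=
  subset_closure (Set.mem_iUnion₂.2 ⟨j, hj,
    Set.smul_mem_smul_set (subset_convexHull ℝ _ ⟨u, hu, rfl⟩)⟩)

theorem mem_noncontainmentSet_iff {A : Set (Fin n → ℝ)} (hA : A ⊆ Set.Ici 0)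
    {S : Set (Fin n →₀ ℕ)} (hS : S.Finite) {c : ℝ} :
    c ∈ noncontainmentSet A
        (newtonPolyhedron (Ideal.span ((fun u => monomial u (1 : k)) '' S))) ↔
      0 < c ∧ ∃ v ∈ A, ∃ w ∈ blocker S, c * (v ⬝ᵥ w) < 1 := by
  refine and_congr_right fun hc => ?_
  rw [Set.not_subset]
  constructor
  · rintro ⟨_, ⟨v, hv, rfl⟩, hn⟩
    have hcv : 0 ≤ c • v := smul_nonneg hc.le (hA hv)
    rw [mem_newtonPolyhedron_span_iff hS] at hn
    push Not at hn
    obtain ⟨w, hw, hlt⟩ := hn hcv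
    rw [smul_dotProduct, smul_eq_mul] at hlt
    exact ⟨v, hv, w, hw, hlt⟩
  · rintro ⟨v, hv, w, hw, hlt⟩
    refine ⟨c • v, Set.smul_mem_smul_set hv, fun hmem => ?_⟩
    have := ((mem_newtonPolyhedron_span_iff hS).1 hmem).2 w hw
    rw [smul_dotProduct, smul_eq_mul] at this
    linarith

/-- A linear functional that is small somewhere on the Newton-Okounkov body is small at a
rescaled exponent of one of the ideals. -/
theorem exists_monomial_dotProduct_lt {a : ℕ → Ideal (MvPolynomial (Fin n) k)}
    {v w : Fin n → ℝ} (hv : v ∈ newtonOkounkovBody a) {r : ℝ} (hr : v ⬝ᵥ w < r) :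
    ∃ j, 1 ≤ j ∧ ∃ u, monomial u (1 : k) ∈ a j ∧ expVec u ⬝ᵥ w < r * j := by
  have hopen : IsOpen {x : Fin n → ℝ | x ⬝ᵥ w < r} :=
    isOpen_lt (by unfold dotProduct; fun_prop) continuous_const
  obtain ⟨x, hx, hxU⟩ := mem_closure_iff.1 hv _ hopen hr
  obtain ⟨j, hj, y, hy, rfl⟩ := Set.mem_iUnion₂.1 hxU
  have hj0 : (0 : ℝ) < j := by exact_mod_cast hj
  refine ⟨j, hj, ?_⟩
  -- A half-space containing all exponents of `a j` would contain their hull, hence `y`.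
  by_contra! hall
  have hconv : Convex ℝ {x : Fin n → ℝ | r * j ≤ x ⬝ᵥ w} :=
    convex_halfSpace_ge (f := fun x : Fin n → ℝ => x ⬝ᵥ w)
      ⟨fun a b => add_dotProduct a b w, fun c a => smul_dotProduct c a w⟩ _
  have hle : r * j ≤ y ⬝ᵥ w := by
    refine convexHull_min ?_ hconv hy
    rintro _ ⟨u, hu, rfl⟩
    exact hall u hu
  have hx' : ((1 / (j : ℝ)) • y) ⬝ᵥ w < r := hx
  rw [smul_dotProduct, smul_eq_mul, one_div, ← div_eq_inv_mul, div_lt_iff₀ hj0] at hx'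
  linarith

theorem le_sSup_coe_of_forall_lt {T : Set EReal} {x : EReal} (hx : 0 < x)
    (h : ∀ q : ℝ, 0 < q → (q : EReal) < x → ∃ y ∈ T, (q : EReal) ≤ y) : x ≤ sSup T := by
  by_contra! hlt
  obtain ⟨p, hp0, hpx⟩ := EReal.lt_iff_exists_real_btwn.1 hx
  obtain ⟨q, hq, hqx⟩ := EReal.lt_iff_exists_real_btwn.1 hlt
  -- The maximum keeps the test value positive even when `sSup T` is negative or `-∞`.
  obtain ⟨y, hy, hqy⟩ := h (max p q) (lt_max_of_lt_left (by exact_mod_cast hp0))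
    (by rcases max_choice p q with h | h <;> rw [h] <;> assumption)
  have h1 : (q : EReal) ≤ ((max p q : ℝ) : EReal) := EReal.coe_le_coe_iff.2 (le_max_right _ _)
  exact absurd (le_sSup hy) (not_le.2 (hq.trans_le (h1.trans hqy)))

/-- One noncontainment, at a single `t ≥ 1`, already gives a monomial witnessing every `q < s / r`.
-/
theorem asympResurgence_le {a : ℕ → Ideal (MvPolynomial (Fin n) k)}
    (ha : ∀ i, 1 ≤ i → IsMonomialIdeal (a i)) (S : Set (Fin n →₀ ℕ)) :
    asympResurgence a (fun i => idealIntegralClosure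
        ((Ideal.span ((fun u => monomial u (1 : k)) '' S)) ^ i)) ≤
      sSup (Real.toEReal '' noncontainmentSet (newtonOkounkovBody a)
        (newtonPolyhedron (Ideal.span ((fun u => monomial u (1 : k)) '' S)))) := by
  refine sSup_le ?_
  rintro _ ⟨s, r, hs, hr, hev, rfl⟩
  obtain ⟨t, hnle, ht⟩ := (hev.and (Filter.eventually_ge_atTop 1)).exists
  have hst : 1 ≤ s * t := Nat.mul_pos hs ht
  have hrt : 1 ≤ r * t := Nat.mul_pos hr ht
  obtain ⟨u, hua, hun⟩ := exists_monomial_of_not_le (ha _ hst) hnle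
  have hs0 : (0 : ℝ) < s := by exact_mod_cast hs
  have hr0 : (0 : ℝ) < r := by exact_mod_cast hr
  have ht0 : (0 : ℝ) < t := by exact_mod_cast ht
  have hsr : (0 : ℝ) < s / r := by positivity
  refine le_sSup_coe_of_forall_lt (by exact_mod_cast hsr) fun q hq hqs => ?_
  have hqs' : q < s / r := by exact_mod_cast hqs
  refine ⟨q, ⟨q, ⟨hq, fun hsub => hun ?_⟩, rfl⟩, le_rfl⟩
  -- This `θ` satisfies `q / (s * t) = θ / (r * t)`.
  refine monomial_mem_integralClosure hrt (θ := q / (s / r)) (by positivity)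
    ((div_lt_one hsr).2 hqs') ?_
  have := hsub (Set.smul_mem_smul_set (smul_expVec_mem_newtonOkounkovBody hst hua))
  rw [smul_smul] at this
  convert this using 2
  push_cast
  field_simp

/-- Powers of one monomial of `a j` with small `w`-weight stay outside the integral closures, for
every rational slope below `c`. -/
theorem le_asympResurgence {a : ℕ → Ideal (MvPolynomial (Fin n) k)}
    (ha : IsGradedFamily a) {S : Set (Fin n →₀ ℕ)} (hS : S.Finite) :
    sSup (Real.toEReal '' noncontainmentSet (newtonOkounkovBody a)
        (newtonPolyhedron (Ideal.span ((fun u => monomial u (1 : k)) '' S)))) ≤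
      asympResurgence a (fun i => idealIntegralClosure
        ((Ideal.span ((fun u => monomial u (1 : k)) '' S)) ^ i)) := by
  refine sSup_le ?_
  rintro _ ⟨c, hc, rfl⟩
  obtain ⟨hc0, v, hv, w, hw, hlt⟩ :=
    (mem_noncontainmentSet_iff (newtonOkounkovBody_nonneg a) hS).1 hc
  rw [← lt_div_iff₀' hc0] at hlt
  obtain ⟨j, hj, u, hu, huw⟩ := exists_monomial_dotProduct_lt hv hlt
  have huw0 : 0 ≤ expVec u ⬝ᵥ w := dotProduct_nonneg_of_nonneg (expVec_nonneg u) hw.1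
  have hj0 : (0 : ℝ) < j := by exact_mod_cast hj
  refine le_sSup_coe_of_forall_lt (by exact_mod_cast hc0) fun q hq hqc => ?_
  obtain ⟨ρ, hqρ, hρc⟩ := exists_rat_btwn (EReal.coe_lt_coe_iff.1 hqc)
  have hρ0 : (0 : ℝ) < ρ := hq.trans hqρ
  have hρ0' : 0 < ρ := by exact_mod_cast hρ0
  obtain ⟨s, hs⟩ := Int.eq_ofNat_of_zero_le (Rat.num_pos.2 hρ0').le
  have hs1 : 1 ≤ s := by
    have := Rat.num_pos.2 hρ0'
    omega
  have hden : (0 : ℝ) < ρ.den := by exact_mod_cast ρ.den_pos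
  have hρ : (ρ : ℝ) = s / ρ.den := by
    rw [Rat.cast_def, hs]
    simp
  -- Both terms of the fraction carry the factor `j`, since powers of the chosen monomial are only
  -- known to lie in the `a (j * t)`.
  refine ⟨((ρ : ℝ) : EReal), ⟨j * s, j * ρ.den, Nat.mul_pos hj hs1, Nat.mul_pos hj ρ.den_pos,
    ?_, ?_⟩, EReal.coe_le_coe_iff.2 hqρ.le⟩
  · filter_upwards [Filter.eventually_ge_atTop 1] with t ht hle
    have ht0 : (0 : ℝ) < t := by exact_mod_cast ht
    have hmem := hle (mul_assoc j s t ▸ ha.pow_mem hj hu (Nat.mul_pos hs1 ht))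
    rw [monomial_pow, one_pow] at hmem
    have := le_of_monomial_mem_integralClosure hw hmem
    rw [expVec_nsmul, smul_dotProduct, smul_eq_mul] at this
    push_cast at this
    have h1 : (j * ρ.den : ℝ) ≤ s * (expVec u ⬝ᵥ w) := by
      refine le_of_mul_le_mul_right ?_ ht0
      linarith
    have h2 : (j : ℝ) ≤ ρ * (expVec u ⬝ᵥ w) := by
      rw [hρ, div_mul_eq_mul_div, le_div_iff₀ hden]
      exact h1
    have h3 : (ρ : ℝ) * (expVec u ⬝ᵥ w) ≤ c * (expVec u ⬝ᵥ w) :=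
      mul_le_mul_of_nonneg_right hρc.le huw0
    rw [one_div, ← div_eq_inv_mul, lt_div_iff₀' hc0] at huw
    linarith
  · rw [hρ]
    push_cast
    rw [mul_div_mul_left _ _ hj0.ne']

theorem sSup_noncontainmentSet_eq {A : Set (Fin n → ℝ)} (hA : A ⊆ Set.Ici 0)
    {S : Set (Fin n →₀ ℕ)} (hS : S.Finite)
    (hne : (noncontainmentSet A
      (newtonPolyhedron (Ideal.span ((fun u => monomial u (1 : k)) '' S)))).Nonempty) :
    sSup (Real.toEReal '' noncontainmentSet A
        (newtonPolyhedron (Ideal.span ((fun u => monomial u (1 : k)) '' S)))) =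
      ((1 / infDot A (blocker S) : ℝ≥0∞) : EReal) := by
  have hle : ∀ c ∈ noncontainmentSet A
      (newtonPolyhedron (Ideal.span ((fun u => monomial u (1 : k)) '' S))),
      (c : EReal) ≤ ((1 / infDot A (blocker S) : ℝ≥0∞) : EReal) := by
    intro c hc
    obtain ⟨hc0, v, hv, w, hw, hlt⟩ := (mem_noncontainmentSet_iff hA hS).1 hc
    have h1 : infDot A (blocker S) ≤ ENNReal.ofReal (v ⬝ᵥ w) := sInf_le ⟨v, hv, w, hw, rfl⟩
    have h2 : ENNReal.ofReal c ≤ 1 / infDot A (blocker S) := by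
      rw [one_div, ENNReal.le_inv_iff_mul_le]
      calc ENNReal.ofReal c * infDot A (blocker S)
          ≤ ENNReal.ofReal c * ENNReal.ofReal (v ⬝ᵥ w) := by gcongr
        _ = ENNReal.ofReal (c * (v ⬝ᵥ w)) := (ENNReal.ofReal_mul hc0.le).symm
        _ ≤ 1 := ENNReal.ofReal_le_one.2 hlt.le
    have h3 := EReal.coe_ennreal_le_coe_ennreal_iff.2 h2
    rwa [EReal.coe_ennreal_ofReal, max_eq_left hc0.le] at h3
  apply le_antisymm
  · refine sSup_le ?_
    rintro _ ⟨c, hc, rfl⟩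
    exact hle c hc
  · obtain ⟨c₀, hc₀⟩ := hne
    -- Nonemptiness makes the right side positive; for an empty set the left side would be `-∞`.
    refine le_sSup_coe_of_forall_lt (lt_of_lt_of_le (by exact_mod_cast hc₀.1) (hle c₀ hc₀))
      fun q hq hqx => ?_
    refine ⟨q, ⟨q, (mem_noncontainmentSet_iff hA hS).2 ⟨hq, ?_⟩, rfl⟩, le_rfl⟩
    have h1 : ENNReal.ofReal q < (infDot A (blocker S))⁻¹ := by
      rw [← one_div, ← EReal.coe_ennreal_lt_coe_ennreal_iff, EReal.coe_ennreal_ofReal,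
        max_eq_left hq.le]
      exact hqx
    obtain ⟨_, ⟨v, hv, w, hw, rfl⟩, hlt⟩ := sInf_lt_iff.1 (ENNReal.lt_inv_iff_lt_inv.1 h1)
    refine ⟨v, hv, w, hw, ?_⟩
    rw [← ENNReal.ofReal_inv_of_pos hq, ENNReal.ofReal_lt_ofReal_iff (by positivity)] at hlt
    rwa [← lt_inv_mul_iff₀ hq, mul_one]

theorem finite_of_squarefree {S : Set (Fin n →₀ ℕ)} (hS : ∀ u ∈ S, ∀ i, u i ≤ 1) :
    S.Finite := by
  classical
  exact (Finset.finite_toSet (Finset.Iic (Finsupp.equivFunOnFinite.symm fun _ => 1))).subset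
    fun u hu => Finset.mem_coe.2 (Finset.mem_Iic.2 fun i => hS u hu i)

end NoncontainmentThreshold

end AsympRes

/-- The reciprocal in the last formula is taken in `[0, ∞]`, so that `1 / 0 = ∞`. -/
theorem corollary2p9 {k : Type*} [Field k] (n : ℕ)
    (a : ℕ → Ideal (MvPolynomial (Fin n) k)) (b : Ideal (MvPolynomial (Fin n) k))
    (ha_graded : AsympRes.IsGradedFamily a)
    (ha_monomial : ∀ i : ℕ, 1 ≤ i → AsympRes.IsMonomialIdeal (a i))
    (hb : AsympRes.IsSquarefreeMonomialIdeal b) :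
    AsympRes.asympResurgence a (fun i => AsympRes.idealIntegralClosure (b ^ i)) =
        sSup (Real.toEReal '' AsympRes.noncontainmentSet (AsympRes.newtonOkounkovBody a)
          (AsympRes.newtonPolyhedron b)) ∧
      ((AsympRes.noncontainmentSet (AsympRes.newtonOkounkovBody a)
          (AsympRes.newtonPolyhedron b)).Nonempty →
        sSup (Real.toEReal '' AsympRes.noncontainmentSet (AsympRes.newtonOkounkovBody a)
            (AsympRes.newtonPolyhedron b)) =
          ((1 / AsympRes.infDot (AsympRes.newtonOkounkovBody a)
            (AsympRes.symbolicPolyhedron (AsympRes.alexanderDual b)) : ℝ≥0∞) : EReal)) := by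
  obtain ⟨S, hS, rfl⟩ := hb
  have hfin := AsympRes.finite_of_squarefree hS
  rw [AsympRes.symbolicPolyhedron_alexanderDual hS]
  exact ⟨le_antisymm (AsympRes.asympResurgence_le ha_monomial S)
      (AsympRes.le_asympResurgence ha_graded hfin),
    AsympRes.sSup_noncontainmentSet_eq (AsympRes.newtonOkounkovBody_nonneg a) hfin⟩
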